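/- **Setting.** Let $0\le\gamma<1$, $\alpha=\frac{4}{3+\gamma}$, let $\Omega\subset\mathbb R^n$ be a bounded domain, and let $\Delta_\infty u=\sum_{i,j}D_{ij}u\,D_iu\,D_ju$. Let $\delta>0$ and let $\mathcal B:\mathbb R\to\mathbb R$ be Lipschitz with $0\le\mathcal B\le1$ on $[0,\infty)$, $\mathcal B=0$ on $(-\infty,\delta/2]$ and $\mathcal B=1$ on $[\delta,\infty)$; for $\varepsilon>0$ put $\mathcal B_\varepsilon(s)=\mathcal B(s/\varepsilon^\alpha)$. For nonnegative boundary data $\varphi_\varepsilon$ on $\partial\Omega$ consider $$(P_\varepsilon)\qquad \Delta_\infty u=\mathcal B_\varepsilon(u)\,u^{-\gamma}\ \text{ in }\Omega,\qquad u=\varphi_\varepsilon\ \text{ on }\partial\Omega .$$ The minimal solution of $(P_\varepsilon)$ is the nonnegative viscosity solution $u_\varepsilon\in C(\overline\Omega)$ with $u_\varepsilon\le w$ for every nonnegative viscosity supersolution $w\in C(\overline\Omega)$ with $w=\varphi_\varepsilon$ on $\partial\Omega$. Let $u:\Omega\to\mathbb R$ be a limiting solution: there are $\varepsilon_k\to0^+$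 and nonnegative boundary data $\varphi_{\varepsilon_k}\to\varphi$ pointwise on $\partial\Omega$ such that the minimal solutions $u_{\varepsilon_k}$ of $(P_{\varepsilon_k})$ converge to $u$ locally uniformly in $\Omega$; assume $u\in L^\infty(\Omega)$. Write $\{u>0\}=\{x\in\Omega: u(x)>0\}$. Let $\Omega'\Subset\Omega$ be a subdomain, and let $\operatorname{dist}(\Omega',\partial\Omega)=\inf\{|a-b|:a\in\Omega',\,b\in\partial\Omega\}$. **Corollary (uniform density estimates).** There are constants $c>0$ and $\tau\in(0,\frac12)$, depending only on $n$, $\gamma$, $\operatorname{dist}(\Omega',\partial\Omega)$ and an upper bound for $\|u\|_{L^\infty(\Omega)}$, such that: 1. for every $x\in\Omega'\cap\{u>0\}$ and every $0<\kappa<\operatorname{dist}(\Omega',\partial\Omega)$, $$\frac{\mathcal L^n\big(B_\kappa(x)\cap\{u>0\}\big)}{\mathcal L^n\big(B_\kappa(x)\big)}\ \ge\ c;$$ 2. the free boundary is $\tau$-porous in $\Omega'$: for every $x\in\Omega'\cap\partial\{u>0\}$ and every $0<\rho<\operatorname{dist}(\Omega',\partial\Omega)$ there is $y\in\mathbb R^n$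 with $B_{\tau\rho}(y)\subset B_\rho(x)\setminus\partial\{u>0\}$. -/

import Mathlib

open Set Filter Topology MeasureTheory
open scoped ENNReal NNReal

namespace SingInfLap

/-- The Euclidean space `ℝⁿ`. -/
abbrev Rn (n : ℕ) : Type := EuclideanSpace ℝ (Fin n)

/-- The infinity Laplacian `Δ_∞ φ = ∑ᵢⱼ Dᵢⱼφ Dᵢφ Dⱼφ = ⟨D²φ Dφ, Dφ⟩`, written without coordinates:
the second derivative of `φ` at `x`, evaluated twice on the gradient of `φ` at `x`. It is only
evaluated at points near which `φ` is of class `C²`. -/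
noncomputable def infLaplacian {n : ℕ} (φ : Rn n → ℝ) (x : Rn n) : ℝ :=
  fderiv ℝ (fderiv ℝ φ) x (gradient φ x) (gradient φ x)

/-- `u` satisfies `Δ_∞ u ≥ G(u)` in the viscosity sense in the open set `Ω`. -/
def IsViscositySubsolution {n : ℕ} (Ω : Set (Rn n)) (G : ℝ → ℝ) (u : Rn n → ℝ) : Prop :=
  ∀ x ∈ Ω, ∀ φ : Rn n → ℝ, ContDiffAt ℝ 2 φ x →
    IsLocalMax (fun y => u y - φ y) x → G (u x) ≤ infLaplacian φ x

/-- `u` satisfies `Δ_∞ u ≤ G(u)` in the viscosity sense in the open set `Ω`. -/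
def IsViscositySupersolution {n : ℕ} (Ω : Set (Rn n)) (G : ℝ → ℝ) (u : Rn n → ℝ) : Prop :=
  ∀ x ∈ Ω, ∀ φ : Rn n → ℝ, ContDiffAt ℝ 2 φ x →
    IsLocalMin (fun y => u y - φ y) x → infLaplacian φ x ≤ G (u x)

/-- The exponent `α = 4 / (3 + γ)`. -/
noncomputable def alpha (γ : ℝ) : ℝ := 4 / (3 + γ)

/-- A Lipschitz function `𝓑` with `0 ≤ 𝓑 ≤ 1` on `[0, ∞)`, `𝓑 = 0` on `(-∞, δ/2]` and
`𝓑 = 1` on `[δ, ∞)`. -/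
structure IsCutoff (δ : ℝ) (B : ℝ → ℝ) : Prop where
  lipschitz : ∃ K : ℝ≥0, LipschitzWith K B
  nonneg : ∀ s, 0 ≤ s → 0 ≤ B s
  le_one : ∀ s, 0 ≤ s → B s ≤ 1
  eq_zero : ∀ s, s ≤ δ / 2 → B s = 0
  eq_one : ∀ s, δ ≤ s → B s = 1

/-- The penalized source `s ↦ 𝓑_ε(s) s^{-γ}`, `𝓑_ε(s) = 𝓑(s / ε^α)`. For a cutoff `𝓑` as above it
vanishes for `s ≤ δ ε^α / 2`, whatever value the power has at `s ≤ 0`. -/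
noncomputable def source (γ : ℝ) (B : ℝ → ℝ) (ε s : ℝ) : ℝ :=
  B (s / ε ^ alpha γ) * s ^ (-γ)

/-- The class over which the infimum is taken in Perron's method for
`Δ_∞ w = G(w)` in `Ω`, `w = φ` on `∂Ω`: nonnegative functions, continuous on the closure of `Ω`,
that are viscosity supersolutions in `Ω` and attain the boundary data. -/
structure IsPerronSupersolution {n : ℕ} (Ω : Set (Rn n)) (G : ℝ → ℝ) (φ w : Rn n → ℝ) :
    Prop where
  continuousOn : ContinuousOn w (closure Ω)
  nonneg : ∀ x ∈ closure Ω, 0 ≤ w x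
  supersolution : IsViscositySupersolution Ω G w
  boundary : ∀ x ∈ frontier Ω, w x = φ x

/-- The minimal (Perron) viscosity solution of `Δ_∞ u = G(u)` in `Ω`, `u = φ` on `∂Ω`: a nonnegative
viscosity solution, continuous on the closure of `Ω`, that attains the boundary data and lies
below every member of the Perron class. -/
structure IsMinimalSolution {n : ℕ} (Ω : Set (Rn n)) (G : ℝ → ℝ) (φ u : Rn n → ℝ) :
    Prop extends IsPerronSupersolution Ω G φ u where
  subsolution : IsViscositySubsolution Ω G u
  minimal : ∀ w : Rn n → ℝ, IsPerronSupersolution Ω G φ w → ∀ x ∈ closure Ω, u x ≤ w x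

/-- `u` is a limiting solution of `Δ_∞ u = u^{-γ}` in `Ω ∩ {u > 0}`, `u = φ` on `∂Ω`: for some
sequence `ε_k → 0⁺` and nonnegative boundary data `φ_k → φ`, it is the locally uniform limit in `Ω`
of the minimal solutions `u_k` of the penalized problems
`Δ_∞ u_k = 𝓑_{ε_k}(u_k) u_k^{-γ}` in `Ω`, `u_k = φ_k` on `∂Ω`. -/
def IsLimitingSolution {n : ℕ} (γ : ℝ) (B : ℝ → ℝ) (Ω : Set (Rn n)) (φ u : Rn n → ℝ) : Prop :=
  ∃ (ε : ℕ → ℝ) (φs us : ℕ → Rn n → ℝ),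
    (∀ k, 0 < ε k) ∧ Tendsto ε atTop (𝓝 0) ∧
    (∀ k, ∀ x ∈ frontier Ω, 0 ≤ φs k x) ∧
    (∀ x ∈ frontier Ω, Tendsto (fun k => φs k x) atTop (𝓝 (φ x))) ∧
    (∀ k, IsMinimalSolution Ω (source γ B (ε k)) (φs k) (us k)) ∧
    TendstoLocallyUniformlyOn us u atTop Ω

/-- The positivity set `{u > 0} = {x ∈ Ω : u(x) > 0}`. -/
def posSet {n : ℕ} (Ω : Set (Rn n)) (u : Rn n → ℝ) : Set (Rn n) := {x ∈ Ω | 0 < u x}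

/-- The distance `inf {|a - b| : a ∈ A, b ∈ B}` between two (nonempty) sets. -/
noncomputable def setDist {n : ℕ} (A B : Set (Rn n)) : ℝ :=
  sInf {r : ℝ | ∃ a ∈ A, ∃ b ∈ B, r = dist a b}

/-- Porosity of `E` at `x` with constant `τ`, at all radii `ρ < ρ₀`: the ball `B_ρ(x)` contains a
ball of radius `τ ρ` that does not meet `E`. -/
def PorousAt {n : ℕ} (τ ρ₀ : ℝ) (E : Set (Rn n)) (x : Rn n) : Prop :=
  ∀ ρ : ℝ, 0 < ρ → ρ < ρ₀ → ∃ y : Rn n, Metric.ball y (τ * ρ) ⊆ Metric.ball x ρ \ E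

end SingInfLap

namespace SingInfLap

variable {n : ℕ}

/-- The infinity Laplacian of a function of the squared distance to a point. -/
theorem infLaplacian_comp_normSq {F F' : ℝ → ℝ} {F'' : ℝ} {p z : Rn n}
    (hF : ∀ᶠ s in 𝓝 (‖p - z‖ ^ 2), HasDerivAt F (F' s) s)
    (hF' : HasDerivAt F' F'' (‖p - z‖ ^ 2)) :
    infLaplacian (fun y => F (‖y - z‖ ^ 2)) p =
      16 * F'' * F' (‖p - z‖ ^ 2) ^ 2 * (‖p - z‖ ^ 2) ^ 2
        + 8 * F' (‖p - z‖ ^ 2) ^ 3 * ‖p - z‖ ^ 2 := by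
  have hq : ∀ y : Rn n, HasFDerivAt (fun y : Rn n => ‖y - z‖ ^ 2)
      ((2 : ℝ) • innerSL ℝ (y - z)) y := fun y => by
    refine ((hasFDerivAt_id y).sub_const z).norm_sq.congr_fderiv ?_
    ext v
    simp
  have hcont : ContinuousAt (fun y : Rn n => ‖y - z‖ ^ 2) p := (hq p).continuousAt
  have hfd : fderiv ℝ (fun y : Rn n => F (‖y - z‖ ^ 2)) =ᶠ[𝓝 p]
      fun y => F' (‖y - z‖ ^ 2) • ((2 : ℝ) • innerSL ℝ (y - z)) := by
    filter_upwards [hcont.eventually hF] with y hy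
    exact (hy.comp_hasFDerivAt y (hq y)).fderiv
  obtain ⟨T, hT, hlin⟩ : ∃ T : Rn n →L[ℝ] Rn n →L[ℝ] ℝ, (∀ v w, T v w = 2 * inner ℝ v w) ∧
      HasFDerivAt (fun y : Rn n => (2 : ℝ) • innerSL ℝ (y - z)) T p := by
    refine ⟨(2 : ℝ) • innerSL ℝ, fun v w => rfl, ?_⟩
    have h := ((innerSL ℝ (E := Rn n)).hasFDerivAt (x := p - z)).comp p
      ((hasFDerivAt_id p).sub_const z)
    exact (h.const_smul (2 : ℝ)).congr_fderiv (by ext; simp)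
  have h2 : fderiv ℝ (fun y => F' (‖y - z‖ ^ 2) • ((2 : ℝ) • innerSL ℝ (y - z))) p = _ :=
    ((hF'.comp_hasFDerivAt p (hq p)).smul hlin).fderiv
  have hgrad : gradient (fun y : Rn n => F (‖y - z‖ ^ 2)) p
      = (2 * F' (‖p - z‖ ^ 2)) • (p - z) := by
    rw [gradient, hfd.self_of_nhds]
    apply (InnerProductSpace.toDual ℝ (Rn n)).injective
    rw [LinearIsometryEquiv.apply_symm_apply]
    ext y
    simp
    ring
  rw [infLaplacian, hfd.fderiv_eq, h2, hgrad]
  simp only [Function.comp_apply]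
  generalize p - z = e
  simp [hT]
  ring

theorem alpha_pos {γ : ℝ} (hγ : 0 ≤ γ) : 0 < alpha γ := by
  unfold alpha; positivity

theorem one_lt_alpha {γ : ℝ} (hγ : 0 ≤ γ) (hγ1 : γ < 1) : 1 < alpha γ := by
  unfold alpha; rw [lt_div_iff₀ (by linarith)]; linarith

theorem three_mul_alpha_sub_four {γ : ℝ} (hγ : 0 ≤ γ) : 3 * alpha γ - 4 = -(alpha γ * γ) := by
  unfold alpha; field_simp; ring

theorem IsCutoff.source_le {δ γ ε s : ℝ} {B : ℝ → ℝ} (hB : IsCutoff δ B) (hδ : 0 < δ)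
    (hγ : 0 ≤ γ) (hγ1 : γ < 1) (hε : 0 < ε) (hs : 0 ≤ s) :
    source γ B ε s ≤ 3 * (s + δ * ε ^ alpha γ) ^ (-γ) := by
  have he : 0 < ε ^ alpha γ := Real.rpow_pos_of_pos hε _
  have hw : 0 < s + δ * ε ^ alpha γ := by positivity
  unfold source
  rcases le_or_gt (s / ε ^ alpha γ) (δ / 2) with h | h
  · rw [hB.eq_zero _ h, zero_mul]
    positivity
  · have hs' : δ / 2 * ε ^ alpha γ < s := (lt_div_iff₀ he).1 h
    have hspos : 0 < s := lt_of_le_of_lt (by positivity) hs'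
    calc B (s / ε ^ alpha γ) * s ^ (-γ) ≤ 1 * s ^ (-γ) := by
          gcongr
          exact hB.le_one _ (by positivity)
      _ = 3 ^ γ * (3 * s) ^ (-γ) := by
          rw [Real.mul_rpow (by norm_num) hs, ← mul_assoc, ← Real.rpow_add (by norm_num)]
          simp
      _ ≤ 3 * (s + δ * ε ^ alpha γ) ^ (-γ) := by
          have h3 : (3 * s) ^ (-γ) ≤ (s + δ * ε ^ alpha γ) ^ (-γ) :=
            Real.rpow_le_rpow_of_nonpos hw (by linarith) (by linarith)
          refine mul_le_mul ?_ h3 (by positivity) (by norm_num)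
          · calc (3 : ℝ) ^ γ ≤ 3 ^ (1 : ℝ) :=
                Real.rpow_le_rpow_of_exponent_le (by norm_num) hγ1.le
              _ = 3 := by simp

theorem IsCutoff.source_eq {δ γ ε s : ℝ} {B : ℝ → ℝ} (hB : IsCutoff δ B) (hε : 0 < ε)
    (hs : δ * ε ^ alpha γ ≤ s) : source γ B ε s = s ^ (-γ) := by
  unfold source
  rw [hB.eq_one _ ((le_div_iff₀ (Real.rpow_pos_of_pos hε _)).2 hs), one_mul]

/-- The infinity Laplacian of the `α`-th power of a cone, where it is positive and away from its
vertex. -/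
theorem contDiffAt_and_infLaplacian_cone_rpow {a b S : ℝ} {p z : Rn n} (hpz : p ≠ z)
    (hb : 0 < b - S * ‖p - z‖) :
    ContDiffAt ℝ 2 (fun y => (b - S * √(‖y - z‖ ^ 2)) ^ a) p ∧
      infLaplacian (fun y => (b - S * √(‖y - z‖ ^ 2)) ^ a) p =
        a ^ 3 * (a - 1) * S ^ 4 * (b - S * ‖p - z‖) ^ (3 * a - 4) := by
  have hN : 0 < ‖p - z‖ := norm_pos_iff.2 (sub_ne_zero.2 hpz)
  have hq : ContDiffAt ℝ 2 (fun y : Rn n => ‖y - z‖ ^ 2) p :=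
    (contDiffAt_id.sub contDiffAt_const).norm_sq ℝ
  have hb' : 0 < b - S * √(‖p - z‖ ^ 2) := by rwa [Real.sqrt_sq hN.le]
  refine ⟨?_, ?_⟩
  · refine ContDiffAt.rpow_const_of_ne ?_ hb'.ne'
    exact contDiffAt_const.sub (contDiffAt_const.mul (hq.sqrt (by positivity)))
  set s := ‖p - z‖ ^ 2 with hs
  have hspos : 0 < s := by positivity
  have hsq : √s = ‖p - z‖ := Real.sqrt_sq hN.le
  have hG : ∀ t : ℝ, 0 < t → HasDerivAt (fun t => b - S * √t) (-(S * (1 / (2 * √t)))) t :=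
    fun t ht => ((Real.hasDerivAt_sqrt ht.ne').const_mul S).const_sub b
  have hF : ∀ᶠ t in 𝓝 s, HasDerivAt (fun t => (b - S * √t) ^ a)
      (-(S * (1 / (2 * √t))) * a * (b - S * √t) ^ (a - 1)) t := by
    have hc : ContinuousAt (fun t => b - S * √t) s := by fun_prop
    filter_upwards [lt_mem_nhds hspos, hc.eventually (lt_mem_nhds hb')] with t ht htb
    exact (hG t ht).rpow_const (Or.inl htb.ne')
  have hsqrt0 : 2 * √s ≠ 0 := by rw [hsq]; positivity
  have hF' : HasDerivAt (fun t => -(S * (2 * √t)⁻¹) * a * (b - S * √t) ^ (a - 1))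
      (-(S * (-(2 * (1 / (2 * √s))) / (2 * √s) ^ 2)) * a * (b - S * √s) ^ (a - 1) +
        -(S * (2 * √s)⁻¹) * a *
          (-(S * (1 / (2 * √s))) * (a - 1) * (b - S * √s) ^ (a - 1 - 1))) s :=
    ((((((Real.hasDerivAt_sqrt hspos.ne').const_mul 2).inv hsqrt0).const_mul S).neg.mul_const
    a).mul ((hG s hspos).rpow_const (p := a - 1) (Or.inl hb'.ne')))
  have key := infLaplacian_comp_normSq (F := fun t => (b - S * √t) ^ a)
    (F' := fun t => -(S * (2 * √t)⁻¹) * a * (b - S * √t) ^ (a - 1)) (p := p) (z := z)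
    (by simpa using hF) hF'
  rw [key]
  rw [← hs, hsq]
  rw [hs]
  set N := ‖p - z‖
  set X := b - S * N
  have e1 : X ^ (a - 1) = X * X ^ (a - 2) := by
    rw [show a - 1 = 1 + (a - 2) by ring, Real.rpow_add hb, Real.rpow_one]
  have e2 : X ^ (3 * a - 4) = (X ^ (a - 2)) ^ 3 * X ^ 2 := by
    rw [← Real.rpow_natCast, ← Real.rpow_natCast, ← Real.rpow_mul hb.le, ← Real.rpow_add hb]
    congr 1
    push_cast
    ring
  have e3 : X ^ (a - 1 - 1) = X ^ (a - 2) := by congr 1; ring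
  rw [e3, e1, e2]
  field_simp
  ring

/-- A subsolution of the penalized problem that is positive at the centre of a ball of radius `r`,
above the penalized range, exceeds every level `L` with `8 L ^ (3 + γ) < r ^ 4` on the ball. -/
theorem IsViscositySubsolution.exists_lt {γ δ ε L r : ℝ} {B : ℝ → ℝ} {Ω : Set (Rn n)}
    {u : Rn n → ℝ} {x : Rn n} (hγ : 0 ≤ γ) (hB : IsCutoff δ B) (hδ : 0 < δ) (hε : 0 < ε)
    (hu : IsViscositySubsolution Ω (source γ B ε) u) (hc : ContinuousOn u Ω) (hr : 0 < r)
    (hball : Metric.closedBall x r ⊆ Ω) (hx : δ * ε ^ alpha γ ≤ u x) (hL : 0 < L)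
    (hLr : 8 * L ^ (3 + γ) < r ^ 4) : ∃ z ∈ Metric.closedBall x r, L < u z := by
  by_contra! hcon
  have hux : 0 < u x := lt_of_lt_of_le (by have := Real.rpow_pos_of_pos hε (alpha γ); positivity) hx
  set A : ℝ := L / r ^ 2 with hA
  have hApos : 0 < A := by positivity
  obtain ⟨z, hz, hmax⟩ := (isCompact_closedBall x r).exists_isMaxOn
    ⟨x, Metric.mem_closedBall_self hr.le⟩
    (f := fun y => u y - A * ‖y - x‖ ^ 2) ((hc.mono hball).sub (by fun_prop))
  have hzx : u x ≤ u z - A * ‖z - x‖ ^ 2 := by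
    simpa using hmax (Metric.mem_closedBall_self hr.le)
  have hzL := hcon z hz
  have hlt : ‖z - x‖ < r := by
    by_contra! hge
    have : A * r ^ 2 ≤ A * ‖z - x‖ ^ 2 := by gcongr
    have hAr : A * r ^ 2 = L := by rw [hA]; field_simp
    linarith
  have huz : u x ≤ u z := hzx.trans (by have : 0 ≤ A * ‖z - x‖ ^ 2 := by positivity
                                        linarith)
  have hloc : IsLocalMax (fun y => u y - A * ‖y - x‖ ^ 2) z :=
    hmax.isLocalMax (mem_of_superset (Metric.isOpen_ball.mem_nhds
      (by rwa [Metric.mem_ball, dist_eq_norm])) Metric.ball_subset_closedBall)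
  have hsub := hu z (hball hz) (fun y => A * ‖y - x‖ ^ 2)
    (contDiffAt_const.mul ((contDiffAt_id.sub contDiffAt_const).norm_sq ℝ)) hloc
  rw [hB.source_eq hε (hx.trans huz),
    infLaplacian_comp_normSq (F := fun s => A * s) (F' := fun _ => A) (F'' := 0)
      (Eventually.of_forall fun s => by simpa using (hasDerivAt_id s).const_mul A)
      (hasDerivAt_const _ _)] at hsub
  have h1 : L ^ (-γ) ≤ u z ^ (-γ) :=
    Real.rpow_le_rpow_of_nonpos (hux.trans_le huz) hzL (by linarith)
  have h2 : 8 * A ^ 3 * ‖z - x‖ ^ 2 ≤ 8 * A ^ 3 * r ^ 2 := by gcongr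
  have h3 : L ^ (-γ) ≤ 8 * A ^ 3 * r ^ 2 := by linarith
  have h4 : 8 * A ^ 3 * r ^ 2 = 8 * L ^ 3 / r ^ 4 := by rw [hA]; field_simp
  rw [h4, Real.rpow_neg hL.le, le_div_iff₀ (by positivity), inv_mul_le_iff₀ (by positivity)] at h3
  rw [Real.rpow_add hL] at hLr
  norm_num at hLr
  nlinarith

/-- Comparison from below of a supersolution of the penalized problem with `α`-th powers of
cones. -/
theorem IsViscositySupersolution.cone_le {γ δ ε R S : ℝ} {B : ℝ → ℝ} {Ω : Set (Rn n)}
    {u : Rn n → ℝ} {z : Rn n} (hγ : 0 ≤ γ) (hγ1 : γ < 1) (hB : IsCutoff δ B) (hδ : 0 < δ)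
    (hε : 0 < ε) (hu : IsViscositySupersolution Ω (source γ B ε) u) (hc : ContinuousOn u Ω)
    (hnn : ∀ x ∈ Ω, 0 ≤ u x) (hball : Metric.closedBall z R ⊆ Ω) (hS0 : 0 < S)
    (hS : 3 < alpha γ ^ 3 * (alpha γ - 1) * S ^ 4)
    (hSR : (u z + δ * ε ^ alpha γ) ^ (alpha γ)⁻¹ ≤ S * R) {y : Rn n}
    (hy : y ∈ Metric.closedBall z R) :
    (u z + δ * ε ^ alpha γ) ^ (alpha γ)⁻¹ ≤
      (u y + δ * ε ^ alpha γ) ^ (alpha γ)⁻¹ + S * ‖y - z‖ := by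
  have hα := alpha_pos hγ
  set η := δ * ε ^ alpha γ with hη
  have hηpos : 0 < η := by have := Real.rpow_pos_of_pos hε (alpha γ); positivity
  have hR : 0 ≤ R := dist_nonneg.trans hy
  have hzR : z ∈ Metric.closedBall z R := Metric.mem_closedBall_self hR
  set v : Rn n → ℝ := fun y => (u y + η) ^ (alpha γ)⁻¹ with hv
  have hvc : ContinuousOn v Ω := (hc.add continuousOn_const).rpow_const
    fun x hx => Or.inr (by positivity)
  have hvpos : ∀ x ∈ Ω, 0 < v x := fun x hx => by have := hnn x hx; simp only [hv]; positivity
  have hvpow : ∀ x ∈ Ω, v x ^ alpha γ = u x + η := fun x hx =>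
    Real.rpow_inv_rpow (by have := hnn x hx; positivity) hα.ne'
  obtain ⟨p, hp, hmin⟩ := (isCompact_closedBall z R).exists_isMinOn ⟨z, hzR⟩
    (f := fun y => v y + S * ‖y - z‖) ((hvc.mono hball).add (by fun_prop))
  suffices hgoal : v z ≤ v p + S * ‖p - z‖ from hgoal.trans (hmin hy)
  by_contra! hlt
  have hpΩ := hball hp
  have hvp := hvpos p hpΩ
  have hpz : p ≠ z := by rintro rfl; simp at hlt
  have hpR : ‖p - z‖ < R := by
    by_contra! hge
    have : S * R ≤ S * ‖p - z‖ := by gcongr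
    have h' : v z ≤ S * R := hSR
    linarith
  set b := v p + S * ‖p - z‖ with hb
  have hbp : b - S * ‖p - z‖ = v p := by rw [hb]; ring
  obtain ⟨hsm, hlap⟩ := contDiffAt_and_infLaplacian_cone_rpow (a := alpha γ) (b := b) (S := S)
    hpz (by rwa [hbp])
  have hnhds : ∀ᶠ y in 𝓝 p, y ∈ Metric.closedBall z R :=
    mem_of_superset (Metric.isOpen_ball.mem_nhds
      (by rwa [Metric.mem_ball, dist_eq_norm])) Metric.ball_subset_closedBall
  have hpos : ∀ᶠ y in 𝓝 p, 0 < b - S * ‖y - z‖ := by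
    have : ContinuousAt (fun y : Rn n => b - S * ‖y - z‖) p := by fun_prop
    exact this.eventually (lt_mem_nhds (by simpa only [hbp] using hvp))
  have hloc : IsLocalMin (fun y => u y - (b - S * √(‖y - z‖ ^ 2)) ^ alpha γ) p := by
    filter_upwards [hnhds, hpos] with y hyR hypos
    simp only [Real.sqrt_sq (norm_nonneg _)]
    rw [hbp, hvpow p hpΩ]
    have h1 : b - S * ‖y - z‖ ≤ v y := by
      have : b ≤ v y + S * ‖y - z‖ := hmin hyR
      linarith
    have h2 : (b - S * ‖y - z‖) ^ alpha γ ≤ v y ^ alpha γ := by gcongr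
    rw [hvpow y (hball hyR)] at h2
    linarith
  have hsup := hu p hpΩ _ hsm hloc
  rw [hlap, hbp] at hsup
  have hsrc := hB.source_le hδ hγ hγ1 hε (hnn p hpΩ)
  rw [← hη, ← hvpow p hpΩ, ← Real.rpow_mul hvp.le,
    show alpha γ * -γ = 3 * alpha γ - 4 by rw [three_mul_alpha_sub_four hγ]; ring] at hsrc
  have hX : 0 < v p ^ (3 * alpha γ - 4) := Real.rpow_pos_of_pos hvp _
  have := mul_lt_mul_of_pos_right hS hX
  linarith

theorem IsLimitingSolution.continuousOn {γ : ℝ} {B : ℝ → ℝ} {Ω : Set (Rn n)} {φ u : Rn n → ℝ}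
    (h : IsLimitingSolution γ B Ω φ u) : ContinuousOn u Ω := by
  obtain ⟨ε, φs, us, -, -, -, -, hmin, hlim⟩ := h
  exact hlim.continuousOn (Frequently.of_forall fun k =>
    (hmin k).continuousOn.mono subset_closure)

theorem IsLimitingSolution.nonneg {γ : ℝ} {B : ℝ → ℝ} {Ω : Set (Rn n)} {φ u : Rn n → ℝ}
    (h : IsLimitingSolution γ B Ω φ u) {x : Rn n} (hx : x ∈ Ω) : 0 ≤ u x := by
  obtain ⟨ε, φs, us, -, -, -, -, hmin, hlim⟩ := h
  exact ge_of_tendsto' (hlim.tendsto_at hx) fun k => (hmin k).nonneg x (subset_closure hx)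

theorem tendsto_mul_rpow_alpha {γ δ : ℝ} (hγ : 0 ≤ γ) {ε : ℕ → ℝ}
    (hε : Tendsto ε atTop (𝓝 0)) : Tendsto (fun k => δ * ε k ^ alpha γ) atTop (𝓝 0) := by
  have h := (hε.rpow_const (Or.inr (alpha_pos hγ).le)).const_mul δ
  rwa [Real.zero_rpow (alpha_pos hγ).ne', mul_zero] at h

/-- Nondegeneracy of limiting solutions, for `u ^ (1 / α)`. -/
theorem IsLimitingSolution.exists_half_le {γ δ r : ℝ} {B : ℝ → ℝ} {Ω : Set (Rn n)}
    {φ u : Rn n → ℝ} {x : Rn n} (h : IsLimitingSolution γ B Ω φ u) (hγ : 0 ≤ γ)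
    (hB : IsCutoff δ B) (hδ : 0 < δ) (hΩ : IsOpen Ω) (hr : 0 < r)
    (hball : Metric.closedBall x r ⊆ Ω) (hx : 0 < u x) :
    ∃ z ∈ Metric.closedBall x r, r / 2 ≤ u z ^ (alpha γ)⁻¹ := by
  have huc := h.continuousOn
  have hnn := fun x hx => h.nonneg (x := x) hx
  obtain ⟨ε, φs, us, hε, hε0, -, -, hmin, hlim⟩ := h
  have hα := alpha_pos hγ
  have hxr : x ∈ Metric.closedBall x r := Metric.mem_closedBall_self hr.le
  set L : ℝ := (r / 2) ^ alpha γ with hL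
  have hLpos : 0 < L := by positivity
  obtain ⟨z, hz, hmax⟩ := (isCompact_closedBall x r).exists_isMaxOn ⟨x, hxr⟩ (huc.mono hball)
  refine ⟨z, hz, ?_⟩
  by_contra! hlt
  have hzL : u z < L := by
    have := Real.rpow_lt_rpow (Real.rpow_nonneg (hnn z (hball hz)) _) hlt hα
    rwa [Real.rpow_inv_rpow (hnn z (hball hz)) hα.ne'] at this
  have hunif := (tendstoLocallyUniformlyOn_iff_forall_isCompact hΩ).1 hlim _ hball
    (isCompact_closedBall x r)
  have hev := Metric.tendstoUniformlyOn_iff.1 hunif (L - u z) (by linarith)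
  have hηx := (tendsto_mul_rpow_alpha (δ := δ) hγ hε0).eventually_lt
    (hlim.tendsto_at (hball hxr)) hx
  obtain ⟨k, hk, hkx⟩ := (hev.and hηx).exists
  have hLr : 8 * L ^ (3 + γ) < r ^ 4 := by
    have : L ^ (3 + γ) = (r / 2) ^ 4 := by
      rw [hL, ← Real.rpow_mul (by positivity), alpha, div_mul_cancel₀ _ (by positivity)]
      exact_mod_cast Real.rpow_natCast (r / 2) 4
    rw [this]
    have : 0 < r ^ 4 := by positivity
    ring_nf
    linarith
  obtain ⟨y, hy, hyL⟩ := (hmin k).subsolution.exists_lt hγ hB hδ (hε k)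
    ((hmin k).continuousOn.mono subset_closure) hr hball hkx.le hLpos hLr
  have h1 := hk y hy
  rw [Real.dist_eq, abs_lt] at h1
  have h2 : u y ≤ u z := hmax hy
  linarith

/-- The cone comparison for limiting solutions: `u ^ (1 / α)` decreases at most linearly. -/
theorem IsLimitingSolution.cone_le {γ δ R S : ℝ} {B : ℝ → ℝ} {Ω : Set (Rn n)}
    {φ u : Rn n → ℝ} {z : Rn n} (h : IsLimitingSolution γ B Ω φ u) (hγ : 0 ≤ γ) (hγ1 : γ < 1)
    (hB : IsCutoff δ B) (hδ : 0 < δ) (hball : Metric.closedBall z R ⊆ Ω) (hS0 : 0 < S)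
    (hS : 3 < alpha γ ^ 3 * (alpha γ - 1) * S ^ 4) (hSR : u z ^ (alpha γ)⁻¹ < S * R) {y : Rn n}
    (hy : y ∈ Metric.closedBall z R) :
    u z ^ (alpha γ)⁻¹ ≤ u y ^ (alpha γ)⁻¹ + S * ‖y - z‖ := by
  obtain ⟨ε, φs, us, hε, hε0, -, -, hmin, hlim⟩ := h
  have hα := alpha_pos hγ
  have hzR : z ∈ Metric.closedBall z R := Metric.mem_closedBall_self (dist_nonneg.trans hy)
  have ht : ∀ x ∈ Ω, Tendsto (fun k => (us k x + δ * ε k ^ alpha γ) ^ (alpha γ)⁻¹) atTop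
      (𝓝 (u x ^ (alpha γ)⁻¹)) := fun x hx => by
    have := (hlim.tendsto_at hx).add (tendsto_mul_rpow_alpha (δ := δ) hγ hε0)
    rw [add_zero] at this
    exact this.rpow_const (Or.inr (by positivity))
  refine le_of_tendsto_of_tendsto (ht z (hball hzR)) ((ht y (hball hy)).add_const _) ?_
  filter_upwards [(ht z (hball hzR)).eventually (gt_mem_nhds hSR)] with k hk
  exact (hmin k).supersolution.cone_le hγ hγ1 hB hδ (hε k)
    ((hmin k).continuousOn.mono subset_closure)
    (fun x hx => (hmin k).nonneg x (subset_closure hx)) hball hS0 hS hk.le hy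

/-- A ball around `x` of radius at most the distance of a set containing `x` to the boundary
of `Ω` is contained in `Ω`. -/
theorem ball_subset_of_setDist {A Ω : Set (Rn n)} {x : Rn n} (hΩ : IsOpen Ω) (hx : x ∈ A)
    (hxΩ : x ∈ Ω) :
    Metric.ball x (setDist A (frontier Ω)) ⊆ Ω := by
  rcases le_or_gt (setDist A (frontier Ω)) 0 with hd | hd
  · simp [Metric.ball_eq_empty.2 hd]
  refine (convex_ball x _).isPreconnected.subset_of_closure_inter_subset hΩ
    ⟨x, Metric.mem_ball_self hd, hxΩ⟩ ?_
  rintro y ⟨hy, hyx⟩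
  by_contra hyΩ
  rw [Metric.mem_ball, dist_comm] at hyx
  refine hyx.not_ge (csInf_le ⟨0, ?_⟩ ⟨x, hx, y, ⟨hy, by rwa [hΩ.interior_eq]⟩, rfl⟩)
  rintro _ ⟨a, -, b, -, rfl⟩
  exact dist_nonneg

/-- An essential upper bound of a function continuous on an open set is an upper bound. -/
theorem le_of_eLpNorm_top_le {Ω : Set (Rn n)} {u : Rn n → ℝ} {M : ℝ} (hΩ : IsOpen Ω)
    (hu : ContinuousOn u Ω) (h : eLpNorm u ∞ (volume.restrict Ω) ≤ ENNReal.ofReal M)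
    {x : Rn n} (hx : x ∈ Ω) : u x ≤ max M 0 := by
  have hae : ∀ᵐ y ∂volume.restrict Ω, min (u y) (max M 0) = u y := by
    rw [eLpNorm_exponent_top] at h
    filter_upwards [ae_le_eLpNormEssSup (f := u) (μ := volume.restrict Ω)] with y hy
    have h1 := hy.trans h
    rw [← ofReal_norm, ENNReal.ofReal_le_ofReal_iff'] at h1
    have h2 := Real.le_norm_self (u y)
    exact min_eq_left (h1.elim (fun h => le_max_of_le_left (h2.trans h))
      fun h => le_max_of_le_right (h2.trans h))
  exact min_eq_left_iff.1 (Measure.eqOn_open_of_ae_eq hae hΩ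
    (continuous_min.comp_continuousOn (hu.prodMk continuousOn_const)) hu hx)

/-- The balls around points of the positivity set contain balls of comparable radius inside the
positivity set. -/
theorem IsLimitingSolution.exists_ball_subset_posSet {γ δ d S κ N : ℝ} {B : ℝ → ℝ}
    {Ω : Set (Rn n)} {φ u : Rn n → ℝ} {x : Rn n} (h : IsLimitingSolution γ B Ω φ u) (hγ : 0 ≤ γ)
    (hγ1 : γ < 1) (hB : IsCutoff δ B) (hδ : 0 < δ) (hΩ : IsOpen Ω)
    (hN : ∀ y ∈ Ω, u y ≤ N) (hball : Metric.ball x d ⊆ Ω) (hx : 0 < u x) (hκ : 0 < κ)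
    (hκd : κ < d) (hS1 : 1 ≤ S) (hS : 3 < alpha γ ^ 3 * (alpha γ - 1) * S ^ 4)
    (hSN : N ^ (alpha γ)⁻¹ < S * (d / 4)) :
    ∃ z, Metric.ball z (1 / (4 * S) * κ) ⊆ Metric.ball x κ ∩ posSet Ω u := by
  have hα := alpha_pos hγ
  obtain ⟨z, hz, hzκ⟩ := h.exists_half_le hγ hB hδ hΩ (half_pos hκ)
    ((Metric.closedBall_subset_ball (by linarith)).trans hball) hx
  rw [Metric.mem_closedBall] at hz
  have hzΩ : z ∈ Ω := hball (Metric.mem_ball.2 (by linarith))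
  have hzball : Metric.closedBall z (d / 4) ⊆ Ω :=
    (Metric.closedBall_subset_ball' (by linarith)).trans hball
  have hσ : 1 / (4 * S) * κ ≤ κ / 4 := by
    rw [div_mul_eq_mul_div, one_mul, div_le_div_iff₀ (by positivity) (by norm_num)]
    nlinarith
  refine ⟨z, fun y hy => ?_⟩
  rw [Metric.mem_ball] at hy
  have hyz : y ∈ Metric.closedBall z (d / 4) := Metric.mem_closedBall.2 (by linarith)
  refine ⟨Metric.mem_ball.2 (by linarith [dist_triangle y z x]), hzball hyz, ?_⟩
  have hcone := h.cone_le hγ hγ1 hB hδ hzball (by linarith) hS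
    ((Real.rpow_le_rpow (h.nonneg hzΩ) (hN z hzΩ) (by positivity)).trans_lt hSN) hyz
  have hlt : S * ‖y - z‖ < κ / 4 := by
    rw [← dist_eq_norm]
    calc S * dist y z < S * (1 / (4 * S) * κ) := by gcongr
      _ = κ / 4 := by field_simp
  refine (h.nonneg (hzball hyz)).lt_of_ne fun h0 => ?_
  rw [← h0, Real.zero_rpow (by positivity)] at hcone
  linarith

theorem volume_real_ball_mul (x z : Rn n) {σ κ : ℝ} (hσ : 0 < σ) :
    volume.real (Metric.ball z (σ * κ)) = σ ^ n * volume.real (Metric.ball x κ) := by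
  rw [measureReal_def, measureReal_def, Measure.addHaar_ball_mul_of_pos _ _ hσ,
    Measure.addHaar_ball_center _ x]
  simp [hσ.le]

end SingInfLap

open SingInfLap in
theorem corollary5p4 (n : ℕ) (γ : ℝ) (hγ0 : 0 ≤ γ) (hγ1 : γ < 1) (M d : ℝ) :
    ∃ c τ : ℝ, 0 < c ∧ 0 < τ ∧ τ < 1 / 2 ∧
      ∀ (δ : ℝ) (B : ℝ → ℝ) (Ω Ω' : Set (SingInfLap.Rn n)) (φ u : SingInfLap.Rn n → ℝ),
        0 < δ → SingInfLap.IsCutoff δ B →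
        IsOpen Ω → IsConnected Ω → Bornology.IsBounded Ω →
        IsOpen Ω' → IsConnected Ω' → IsCompact (closure Ω') → closure Ω' ⊆ Ω →
        SingInfLap.IsLimitingSolution γ B Ω φ u →
        eLpNorm u ∞ (volume.restrict Ω) ≤ ENNReal.ofReal M →
        SingInfLap.setDist Ω' (frontier Ω) = d →
        (∀ x ∈ Ω' ∩ SingInfLap.posSet Ω u, ∀ κ : ℝ, 0 < κ → κ < d →
          c ≤ volume.real (Metric.ball x κ ∩ SingInfLap.posSet Ω u) /
            volume.real (Metric.ball x κ)) ∧
        (∀ x ∈ Ω' ∩ frontier (SingInfLap.posSet Ω u),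
          SingInfLap.PorousAt τ d (frontier (SingInfLap.posSet Ω u)) x) := by
  have hα := alpha_pos hγ0
  have hα1 := one_lt_alpha hγ0 hγ1
  set N := max M 0 with hN
  have hN0 : 0 ≤ N := le_max_right _ _
  set a := alpha γ ^ 3 * (alpha γ - 1) with ha
  have hapos : 0 < a := mul_pos (by positivity) (by linarith)
  set S : ℝ := 1 + 3 / a + 4 * N ^ (alpha γ)⁻¹ / |d| with hS
  have hS1 : 1 ≤ S := by
    have : 0 ≤ 3 / a + 4 * N ^ (alpha γ)⁻¹ / |d| := by positivity
    rw [hS]; linarith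
  have hS4 : 3 < a * S ^ 4 := by
    have h1 : 3 / a < S := by
      have : 0 ≤ 4 * N ^ (alpha γ)⁻¹ / |d| := by positivity
      rw [hS]; linarith
    rw [div_lt_iff₀' hapos] at h1
    exact h1.trans_le (by gcongr; exact le_self_pow₀ hS1 (by norm_num))
  have hσ : 1 / (4 * S) ≤ 1 / 4 := by gcongr; linarith
  refine ⟨(1 / (4 * S)) ^ n, 1 / (4 * S) / 2, by positivity, by positivity, by linarith, ?_⟩
  intro δ B Ω Ω' φ u hδ hB hΩ _ _ hΩ' _ _ hsub hu hM hd
  have key : ∀ x ∈ Ω' ∩ posSet Ω u, ∀ κ : ℝ, 0 < κ → κ < d →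
      ∃ z, Metric.ball z (1 / (4 * S) * κ) ⊆ Metric.ball x κ ∩ posSet Ω u := by
    rintro x ⟨hx, hxΩ, hux⟩ κ hκ hκd
    have hdpos := hκ.trans hκd
    refine hu.exists_ball_subset_posSet hγ0 hγ1 hB hδ hΩ
      (fun y hy => le_of_eLpNorm_top_le hΩ hu.continuousOn hM hy)
      (hd ▸ ball_subset_of_setDist hΩ hx hxΩ) hux hκ hκd hS1 hS4 ?_
    have h1 : 4 * N ^ (alpha γ)⁻¹ / d < S := by
      have : 0 < 3 / a := by positivity
      rw [hS, abs_of_pos hdpos]; linarith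
    rw [div_lt_iff₀ hdpos] at h1
    linarith
  refine ⟨fun x hx κ hκ hκd => ?_, fun x ⟨hx, hxf⟩ ρ hρ hρd => ?_⟩
  · obtain ⟨z, hz⟩ := key x hx κ hκ hκd
    have hpos : 0 < volume.real (Metric.ball x κ) :=
      ENNReal.toReal_pos (Metric.measure_ball_pos _ _ hκ).ne' measure_ball_lt_top.ne
    rw [le_div_iff₀ hpos, ← volume_real_ball_mul x z (by positivity)]
    exact measureReal_mono hz (measure_ne_top_of_subset inter_subset_left measure_ball_lt_top.ne)
  · obtain ⟨x', ⟨hx'Ω, hx'ρ⟩, hx'⟩ := mem_closure_iff_nhds.1 hxf.1 _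
      (inter_mem (hΩ'.mem_nhds hx) (Metric.ball_mem_nhds x (half_pos hρ)))
    obtain ⟨z, hz⟩ := key x' ⟨hx'Ω, hx'⟩ (ρ / 2) (half_pos hρ) (by linarith)
    rw [Metric.mem_ball] at hx'ρ
    refine ⟨z, fun y hy => ?_⟩
    rw [show 1 / (4 * S) / 2 * ρ = 1 / (4 * S) * (ρ / 2) by ring] at hy
    refine ⟨Metric.ball_subset_ball' (by linarith) (hz hy).1, fun hyf => hyf.2 ?_⟩
    exact mem_interior.2 ⟨_, fun w hw => (hz hw).2, Metric.isOpen_ball, hy⟩
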